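/- Let $F$ be a finitely generated free group of rank at least $2$, let $\varphi : F \to F$ be any injective homomorphism (surjective or not), and let $$G = \langle F, t \mid t f t^{-1} = \varphi(f) \text{ for all } f \in F \rangle$$ be the associated ascending HNN extension. Then $G$ does not have the finitely generated intersection property; that is, there exist finitely generated subgroups $H, K \le G$ such that $H \cap K$ is not finitely generated. -/

import Mathlib

/-- A group has the finitely generated intersection property if the intersection of any two
finitely generated subgroups is finitely generated. -/
def HasFGIP (G : Type*) [Group G] : Prop :=
  ∀ H K : Subgroup G, H.FG → K.FG → (H ⊓ K).FG

/-- The ascending HNN extension `⟨F, t | t f t⁻¹ = φ f for all f ∈ F⟩` of a monomorphism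
`φ : F → F`: the HNN extension of `F` with associated subgroups `F` and `φ(F)`. -/
abbrev AscendingHNNExtension {F : Type*} [Group F] (φ : F →* F)
    (hφ : Function.Injective φ) : Type _ :=
  HNNExtension F ⊤ φ.range (Subgroup.topEquiv.trans (MonoidHom.ofInjective hφ))

theorem AscendingHNNExtension.t_mul_of_mul_t_inv {F : Type*} [Group F] (φ : F →* F)
    (hφ : Function.Injective φ) (f : F) :
    (HNNExtension.t * HNNExtension.of f * HNNExtension.t⁻¹ : AscendingHNNExtension φ hφ) =
      HNNExtension.of (φ f) :=
  (HNNExtension.equiv_eq_conj (φ := Subgroup.topEquiv.trans (MonoidHom.ofInjective hφ))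
    (⟨f, Subgroup.mem_top f⟩ : (⊤ : Subgroup F))).symm

universe u v

/-! ### Free groups: generators and cocycles -/

/-! The base `F` is finitely generated, so the property would make `H ∩ F` finitely generated for
every finitely generated `H` (`comap_of_fg`). The proof exhibits an `H` violating this, according to
the index of `φ(F)`.

Infinite index: by Marshall Hall, `φ(F)` is a free factor, hence a retract, of some `F₁` of finite
index. A nontrivial `b` killed by the retraction gives `⟨b, t⟩ ∩ F = ⟨b, φ b, φ² b, …⟩`, a strictly
increasing union (`not_hasFGIP_of_retraction`).

Finite index: comparing ranks forces `φ` to be an automorphism (`eq_top_of_finiteIndex`). For a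
commutator `x ≠ 1`, the subgroup `N = ⟨t, x⟩ ∩ F` is `φ`-invariant, nontrivial and of infinite
index, as it lies in `[F, F]`. If `N` is finitely generated, Hall gives `F₁ = N * (free)` of finite
index. Some `c * t ^ k` then carries `N` through infinitely many `F₁`-conjugates, which a map to a
wreath product separates by their supports. So `⟨c * t ^ k, N⟩ ∩ F` is not finitely generated
(`exists_twisted_conj_not_fg`). -/

theorem FreeGroupBasis.closure_range_eq_top {ι F : Type*} [Group F] (b : FreeGroupBasis ι F) :
    Subgroup.closure (Set.range b) = ⊤ := by
  let S := Subgroup.closure (Set.range b)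
  let f : F →* S := b.lift fun i => ⟨b i, Subgroup.subset_closure ⟨i, rfl⟩⟩
  have hf : S.subtype.comp f = MonoidHom.id F := b.ext_hom _ _ fun i => by
    have : f (b i) = ⟨b i, Subgroup.subset_closure ⟨i, rfl⟩⟩ :=
      congrFun (b.lift.symm_apply_apply _) i
    simp [this]
  refine eq_top_iff.2 fun x _ => ?_
  have := DFunLike.congr_fun hf x
  rw [← show (f x : F) = x from this]
  exact (f x).2

theorem FreeGroupBasis.lift_apply_basis {ι F H : Type*} [Group F] [Group H]
    (b : FreeGroupBasis ι F) (f : ι → H) (i : ι) : b.lift f (b i) = f i :=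
  congrFun (b.lift.symm_apply_apply f) i

/-- A predicate on a free group holds everywhere if it holds at `1` and is preserved by left
multiplication by basis elements and their inverses. -/
theorem FreeGroupBasis.induction_left {ι F : Type*} [Group F] (b : FreeGroupBasis ι F)
    {p : F → Prop} (one : p 1) (mul : ∀ i g, p g → p (b i * g))
    (inv_mul : ∀ i g, p g → p ((b i)⁻¹ * g)) (g : F) : p g := by
  have hg : g ∈ Subgroup.closure (Set.range b) := b.closure_range_eq_top ▸ Subgroup.mem_top g
  induction hg using Subgroup.closure_induction_left with
  | one => exact one
  | mul_left x hx y _ hy => obtain ⟨i, rfl⟩ := hx; exact mul i y hy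
  | inv_mul_cancel x hx y _ hy => obtain ⟨i, rfl⟩ := hx; exact inv_mul i y hy

/-- Nonabelian cocycles on a free group acting on `Y` may be prescribed on a basis. -/
theorem FreeGroupBasis.exists_cocycle {ι F Y L : Type*} [Group F] [Group L]
    (b : FreeGroupBasis ι F) (σ : F →* Equiv.Perm Y) (l : ι → Y → L) :
    ∃ c : F → Y → L, (∀ g h y, c (g * h) y = c g (σ h y) * c h y) ∧
      ∀ i y, c (b i) y = l i y := by
  -- Skew product action: freeness makes it a homomorphism, and it commutes with right
  -- multiplication by `L`, so the cocycle is the `L`-coordinate of the image of `(y, 1)`.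
  let μ : F →* Equiv.Perm (Y × L) := b.lift fun i =>
    { toFun := fun p => (σ (b i) p.1, l i p.1 * p.2)
      invFun := fun p => ((σ (b i))⁻¹ p.1, (l i ((σ (b i))⁻¹ p.1))⁻¹ * p.2)
      left_inv := fun p => by simp
      right_inv := fun p => by simp }
  have hμ (i : ι) (p : Y × L) : μ (b i) p = (σ (b i) p.1, l i p.1 * p.2) := by
    simp [μ, b.lift_apply_basis]
  have hμ' (i : ι) (p : Y × L) :
      μ (b i)⁻¹ p = ((σ (b i))⁻¹ p.1, (l i ((σ (b i))⁻¹ p.1))⁻¹ * p.2) := by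
    rw [map_inv, Equiv.Perm.inv_eq_iff_eq, hμ]; simp
  have key : ∀ g y u, μ g (y, u) = (σ g y, (μ g (y, 1)).2 * u) := by
    refine b.induction_left ?_ ?_ ?_
    · simp
    · intro i g hg y u
      rw [map_mul, Equiv.Perm.mul_apply, Equiv.Perm.mul_apply, hg, hμ, hμ, hg y 1]
      simp [mul_assoc]
    · intro i g hg y u
      rw [map_mul, Equiv.Perm.mul_apply, Equiv.Perm.mul_apply, hg, hμ', hμ', hg y 1]
      simp [mul_assoc]
  refine ⟨fun g y => (μ g (y, 1)).2, fun g h y => ?_, fun i y => ?_⟩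
  · change (μ (g * h) (y, 1)).2 = (μ g (σ h y, 1)).2 * (μ h (y, 1)).2
    rw [map_mul, Equiv.Perm.mul_apply, key h y 1, key g]
  · simp [hμ]

theorem cocycle_one {F Y L : Type*} [Group F] [Group L] {σ : F →* Equiv.Perm Y} {c : F → Y → L}
    (hc : ∀ g h y, c (g * h) y = c g (σ h y) * c h y) (y : Y) : c 1 y = 1 := by
  have := hc 1 1 y
  simpa using this

theorem cocycle_inv {F Y L : Type*} [Group F] [Group L] {σ : F →* Equiv.Perm Y} {c : F → Y → L}
    (hc : ∀ g h y, c (g * h) y = c g (σ h y) * c h y) (g : F) (y : Y) :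
    c g⁻¹ (σ g y) = (c g y)⁻¹ := by
  have := hc g⁻¹ g y
  rw [inv_mul_cancel, cocycle_one hc] at this
  exact eq_inv_of_mul_eq_one_left this.symm

/-! ### Finitely generated subgroups of free groups are virtually free factors -/

/-- On a finite set a partial injection extends to a permutation. This completes a finite piece of a
Schreier graph to a finite covering in Hall's theorem. -/
theorem Equiv.Perm.exists_perm_of_partial {X : Type*} (f : Equiv.Perm X) (Y : Set X) [Finite Y] :
    ∃ σ : Equiv.Perm Y, ∀ y : Y, f y ∈ Y → (σ y : X) = f y := by
  obtain ⟨σ, hσ⟩ := Equiv.Perm.exists_extending_pair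
    (fun y : {y : Y // f y ∈ Y} => y.1) (fun y => ⟨f y.1, y.2⟩) Subtype.val_injective
    (fun y z h => by
      have : f y.1 = f z.1 := congrArg Subtype.val h
      exact Subtype.ext (Subtype.ext (f.injective this)))
  exact ⟨σ, fun y hy => congrArg Subtype.val (hσ ⟨y, hy⟩)⟩

/-- `b.IsPathIn Y x g`: some word in the basis spells `g` and traces a path from `x` to `g • x`
all of whose later vertices lie in `Y`. -/
inductive FreeGroupBasis.IsPathIn {ι F X : Type*} [Group F] [MulAction F X]
    (b : FreeGroupBasis ι F) (Y : Set X) (x : X) : F → Prop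
  | one : IsPathIn b Y x 1
  | mul (i : ι) (g : F) : IsPathIn b Y x g → (b i * g) • x ∈ Y → IsPathIn b Y x (b i * g)
  | inv_mul (i : ι) (g : F) :
      IsPathIn b Y x g → ((b i)⁻¹ * g) • x ∈ Y → IsPathIn b Y x ((b i)⁻¹ * g)

namespace FreeGroupBasis

variable {ι F X : Type*} [Group F] [MulAction F X] {b : FreeGroupBasis ι F}

theorem IsPathIn.smul_mem {Y : Set X} {x : X} {g : F} (h : b.IsPathIn Y x g) (hx : x ∈ Y) :
    g • x ∈ Y := by
  cases h with
  | one => simpa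
  | mul i g _ h => exact h
  | inv_mul i g _ h => exact h

theorem IsPathIn.mono {Y Z : Set X} (hYZ : Y ⊆ Z) {x : X} {g : F} (h : b.IsPathIn Y x g) :
    b.IsPathIn Z x g := by
  induction h with
  | one => exact .one
  | mul i g _ h ih => exact .mul i g ih (hYZ h)
  | inv_mul i g _ h ih => exact .inv_mul i g ih (hYZ h)

theorem exists_finite_isPathIn (b : FreeGroupBasis ι F) (x : X) (g : F) :
    ∃ Y : Set X, Y.Finite ∧ x ∈ Y ∧ b.IsPathIn Y x g ∧
      ∀ y ∈ Y, ∃ h, b.IsPathIn Y x h ∧ h • x = y := by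
  induction g using b.induction_left with
  | one => exact ⟨{x}, by simp, by simp, .one, fun y hy => ⟨1, .one, by simpa using hy.symm⟩⟩
  | mul i g ih =>
    obtain ⟨Y, hY, hx, hg, hh⟩ := ih
    have hp : b.IsPathIn (insert ((b i * g) • x) Y) x (b i * g) :=
      .mul i g (hg.mono (Set.subset_insert _ _)) (Set.mem_insert _ _)
    refine ⟨_, hY.insert _, Set.mem_insert_of_mem _ hx, hp, ?_⟩
    rintro y (rfl | hy)
    · exact ⟨_, hp, rfl⟩
    · obtain ⟨h, h1, h2⟩ := hh y hy
      exact ⟨h, h1.mono (Set.subset_insert _ _), h2⟩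
  | inv_mul i g ih =>
    obtain ⟨Y, hY, hx, hg, hh⟩ := ih
    have hp : b.IsPathIn (insert (((b i)⁻¹ * g) • x) Y) x ((b i)⁻¹ * g) :=
      .inv_mul i g (hg.mono (Set.subset_insert _ _)) (Set.mem_insert _ _)
    refine ⟨_, hY.insert _, Set.mem_insert_of_mem _ hx, hp, ?_⟩
    rintro y (rfl | hy)
    · exact ⟨_, hp, rfl⟩
    · obtain ⟨h, h1, h2⟩ := hh y hy
      exact ⟨h, h1.mono (Set.subset_insert _ _), h2⟩

/-- The union of the paths spelling the elements of `S` works. The last clause, connectedness,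
supplies the transversal in Hall's theorem. -/
theorem exists_finite_forall_isPathIn (b : FreeGroupBasis ι F) (x : X) {S : Set F}
    (hS : S.Finite) :
    ∃ Y : Set X, Y.Finite ∧ x ∈ Y ∧ (∀ g ∈ S, b.IsPathIn Y x g) ∧
      ∀ y ∈ Y, ∃ h, b.IsPathIn Y x h ∧ h • x = y := by
  choose Z hZ hxZ hpZ hhZ using b.exists_finite_isPathIn x
  refine ⟨insert x (⋃ g ∈ S, Z g), (hS.biUnion fun g _ => hZ g).insert _, Set.mem_insert _ _,
    fun g hg => (hpZ g).mono ?_, ?_⟩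
  · exact (Set.subset_biUnion_of_mem hg).trans (Set.subset_insert _ _)
  · rintro y (rfl | hy)
    · exact ⟨1, .one, one_smul _ _⟩
    · obtain ⟨g, hg, hy⟩ := Set.mem_iUnion₂.1 hy
      obtain ⟨h, h1, h2⟩ := hhZ g y hy
      exact ⟨h, h1.mono ((Set.subset_biUnion_of_mem hg).trans (Set.subset_insert _ _)), h2⟩

end FreeGroupBasis

open Monoid in
/-- **Marshall Hall's theorem**: a finitely generated subgroup of a free group is a free factor
of a subgroup of finite index. -/
theorem FreeGroupBasis.exists_finiteIndex_mulEquiv_coprod {ι : Type u} {F : Type v} [Group F]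
    (b : FreeGroupBasis ι F) (N : Subgroup F) (hN : N.FG) :
    ∃ (F₁ : Subgroup F) (h : N ≤ F₁) (E : Type (max u v)) (Θ : F₁ ≃* Coprod N (FreeGroup E)),
      F₁.FiniteIndex ∧ ∀ n : N, Θ (Subgroup.inclusion h n) = Coprod.inl n := by
  classical
  obtain ⟨S, hSN, hS⟩ := (Subgroup.fg_iff N).1 hN
  obtain ⟨Y, hY, hxY, hpS, hpY⟩ :=
    b.exists_finite_forall_isPathIn (X := F ⧸ N) ((1 : F) : F ⧸ N) hS
  have : Finite Y := hY
  set x₀ : F ⧸ N := ((1 : F) : F ⧸ N) with hx₀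
  let y₀ : Y := ⟨x₀, hxY⟩
  choose s hs using fun i => (MulAction.toPerm (b i) : Equiv.Perm (F ⧸ N)).exists_perm_of_partial Y
  let σ : F →* Equiv.Perm Y := b.lift s
  have hσ (i : ι) (y : Y) (h : b i • (y : F ⧸ N) ∈ Y) : (σ (b i) y : F ⧸ N) = b i • (y : F ⧸ N) := by
    simp only [σ, b.lift_apply_basis]
    exact hs i y h
  have hσ' (i : ι) (y : Y) (h : (b i)⁻¹ • (y : F ⧸ N) ∈ Y) :
      σ (b i)⁻¹ y = ⟨(b i)⁻¹ • (y : F ⧸ N), h⟩ := by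
    rw [map_inv, Equiv.Perm.inv_eq_iff_eq]
    apply Subtype.ext
    rw [hσ _ _ (by simp)]
    simp
  have hτ' : ∀ y : Y, ∃ g, b.IsPathIn Y x₀ g ∧ g • x₀ = y ∧ (y = y₀ → g = 1) := by
    intro y
    by_cases hy : y = y₀
    · exact ⟨1, .one, by simp [hy, y₀], fun _ => rfl⟩
    · obtain ⟨g, h1, h2⟩ := hpY y y.2
      exact ⟨g, h1, h2, fun h => absurd h hy⟩
  choose τ hτp hτx hτ1 using hτ'
  have hτ1 : τ y₀ = 1 := hτ1 _ rfl
  have hmk (g : F) : g • x₀ = (g : F ⧸ N) := by simp [hx₀]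
  have hmem (g h : F) : g • x₀ = h • x₀ ↔ g⁻¹ * h ∈ N := by
    rw [hmk, hmk, QuotientGroup.eq]
  -- The edges invented when completing the partial permutations. Each becomes a free generator,
  -- while an original edge is labelled by the element of `N` that it closes up.
  let E := {p : ι × Y // b p.1 • (p.2 : F ⧸ N) ∉ Y}
  let l : ι → Y → Coprod N (FreeGroup E) := fun i y =>
    if h : b i • (y : F ⧸ N) ∈ Y then
      Coprod.inl ⟨(τ (σ (b i) y))⁻¹ * (b i * τ y), by
        rw [← hmem, hτx, hσ i y h, mul_smul, hτx]⟩
    else Coprod.inr (FreeGroup.of ⟨(i, y), h⟩)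
  obtain ⟨c, hc, hcl⟩ := b.exists_cocycle σ l
  -- Paths inside `Y` use only original edges, so their labels telescope in `N`.
  have hpath : ∀ g, b.IsPathIn Y x₀ g → ((σ g y₀ : Y) : F ⧸ N) = g • x₀ ∧
      ∃ h : (τ (σ g y₀))⁻¹ * g ∈ N, c g y₀ = Coprod.inl ⟨_, h⟩ := by
    intro g hg
    have hN' (g : F) (h : ((σ g y₀ : Y) : F ⧸ N) = g • x₀) : (τ (σ g y₀))⁻¹ * g ∈ N := by
      rw [← hmem, hτx, h]
    induction hg with
    | one =>
      refine ⟨by simp [y₀], by simp [hτ1], ?_⟩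
      rw [cocycle_one hc]
      simp only [map_one, Equiv.Perm.one_apply, hτ1, inv_one, mul_one]
      exact (map_one _).symm
    | mul i g hg h ih =>
      obtain ⟨h1, h2, h3⟩ := ih
      have h4 : b i • ((σ g y₀ : Y) : F ⧸ N) ∈ Y := by rwa [h1, ← mul_smul]
      have h5 : ((σ (b i * g) y₀ : Y) : F ⧸ N) = (b i * g) • x₀ := by
        rw [map_mul, Equiv.Perm.mul_apply, hσ _ _ h4, h1, mul_smul]
      refine ⟨h5, hN' _ h5, ?_⟩
      rw [hc, hcl, h3]
      simp only [l, dif_pos h4]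
      rw [← map_mul]
      congr 1
      apply Subtype.ext
      simp [mul_assoc]
    | inv_mul i g hg h ih =>
      obtain ⟨h1, h2, h3⟩ := ih
      have h4 : (b i)⁻¹ • ((σ g y₀ : Y) : F ⧸ N) ∈ Y := by rwa [h1, ← mul_smul]
      have h5 : ((σ ((b i)⁻¹ * g) y₀ : Y) : F ⧸ N) = ((b i)⁻¹ * g) • x₀ := by
        rw [map_mul, Equiv.Perm.mul_apply, hσ' _ _ h4, mul_smul, ← h1]
      refine ⟨h5, hN' _ h5, ?_⟩
      have h6 : σ g y₀ = σ (b i) (σ ((b i)⁻¹ * g) y₀) := by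
        rw [← Equiv.Perm.mul_apply, ← map_mul]; simp
      have h7 : b i • ((σ ((b i)⁻¹ * g) y₀ : Y) : F ⧸ N) ∈ Y := by
        rw [h5, ← mul_smul]; simp only [mul_inv_cancel_left]; rw [← h1]; exact (σ g y₀).2
      have h8 : c (b i)⁻¹ (σ g y₀) = (l i (σ ((b i)⁻¹ * g) y₀))⁻¹ := by
        rw [h6, cocycle_inv hc, hcl]
      rw [hc, h3, h8]
      simp only [l, dif_pos h7]
      rw [← map_inv, ← map_mul]
      congr 1
      apply Subtype.ext
      simp [mul_assoc]
  let F₁ : Subgroup F := (MulAction.stabilizer (Equiv.Perm Y) y₀).comap σ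
  have hF₁ (g : F) : g ∈ F₁ ↔ σ g y₀ = y₀ := by simp [F₁, MulAction.mem_stabilizer_iff]
  let θ : F₁ →* Coprod N (FreeGroup E) :=
    { toFun := fun g => c g y₀
      map_one' := cocycle_one hc _
      map_mul' := fun g h => by
        have := (hF₁ _).1 h.2
        simp [hc, this] }
  have hSF : S ⊆ F₁ := fun g hg => by
    rw [SetLike.mem_coe, hF₁]
    apply Subtype.ext
    have hgN : g ∈ N := hSN ▸ Subgroup.subset_closure hg
    rw [(hpath g (hpS g hg)).1, hmk]
    exact (QuotientGroup.eq.2 (by simpa using hgN))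
  have hNF : N ≤ F₁ := by rw [← hSN, Subgroup.closure_le]; exact hSF
  have hθN : ∀ n : N, θ (Subgroup.inclusion hNF n) = Coprod.inl n := by
    rintro ⟨n, hn⟩
    have hn' : n ∈ Subgroup.closure S := hSN ▸ hn
    induction hn' using Subgroup.closure_induction with
    | mem g hg =>
      obtain ⟨-, h2, h3⟩ := hpath g (hpS g hg)
      refine h3.trans ?_
      congr 1
      apply Subtype.ext
      simp [(hF₁ g).1 (hSF hg), hτ1]
    | one => exact (map_one θ).trans (map_one Coprod.inl).symm
    | mul x y hx hy ihx ihy =>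
      have hx' : x ∈ N := hSN ▸ hx
      have hy' : y ∈ N := hSN ▸ hy
      have := congrArg₂ (· * ·) (ihx hx') (ihy hy')
      simp only [← map_mul] at this
      exact this
    | inv x hx ihx =>
      have hx' : x ∈ N := hSN ▸ hx
      have := congrArg (·⁻¹) (ihx hx')
      simp only [← map_inv] at this
      exact this
  have hτσ (y : Y) : σ (τ y) y₀ = y := Subtype.ext (by rw [(hpath _ (hτp y)).1, hτx])
  have hτc (y : Y) : c (τ y) y₀ = 1 := by
    obtain ⟨h1, h2, h3⟩ := hpath _ (hτp y)
    rw [h3, ← map_one Coprod.inl]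
    congr 1
    apply Subtype.ext
    simp [hτσ]
  have hloop (g : F) (y : Y) : (τ (σ g y))⁻¹ * (g * τ y) ∈ F₁ := by
    rw [hF₁, map_mul, map_mul, map_inv, Equiv.Perm.mul_apply, Equiv.Perm.mul_apply, hτσ,
      Equiv.Perm.inv_eq_iff_eq, hτσ]
  -- The inverse of `θ`: a new edge goes to its loop through the transversal. Surjectivity holds
  -- because such loops, over all edges, generate the stabilizer.
  let κ : Coprod N (FreeGroup E) →* F₁ := Coprod.lift (Subgroup.inclusion hNF)
    (FreeGroup.lift fun e => ⟨_, hloop (b e.1.1) e.1.2⟩)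
  have hθκ : θ.comp κ = MonoidHom.id _ := by
    refine Coprod.hom_ext ?_ ?_
    · ext n
      simp [κ, hθN]
    · refine FreeGroup.ext_hom _ _ fun e => ?_
      have h1 : κ (Coprod.inr (FreeGroup.of e)) = ⟨_, hloop (b e.1.1) e.1.2⟩ := by simp [κ]
      simp only [MonoidHom.comp_apply, h1, MonoidHom.id_apply]
      change c ((τ (σ (b e.1.1) e.1.2))⁻¹ * (b e.1.1 * τ e.1.2)) y₀ = _
      rw [hc, hc, hτc, map_mul, Equiv.Perm.mul_apply, hτσ, hcl]
      have h2 := cocycle_inv hc (τ (σ (b e.1.1) e.1.2)) y₀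
      rw [hτσ, hτc] at h2
      rw [h2]
      simp [l, dif_neg e.2]
  have hκ : Function.Surjective κ := by
    have hall : ∀ g y, (⟨_, hloop g y⟩ : F₁) ∈ κ.range := by
      have hb (i : ι) (y : Y) : (⟨_, hloop (b i) y⟩ : F₁) ∈ κ.range := by
        by_cases h : b i • (y : F ⧸ N) ∈ Y
        · refine ⟨Coprod.inl ⟨(τ (σ (b i) y))⁻¹ * (b i * τ y), ?_⟩, ?_⟩
          · rw [← hmem, hτx, hσ i y h, mul_smul, hτx]
          · simp [κ, Subgroup.inclusion]
        · exact ⟨Coprod.inr (FreeGroup.of ⟨(i, y), h⟩), by simp [κ]⟩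
      refine b.induction_left ?_ ?_ ?_
      · intro y
        convert κ.range.one_mem
        simp
      · intro i g hg y
        convert κ.range.mul_mem (hb i (σ g y)) (hg y) using 1
        apply Subtype.ext
        simp [mul_assoc]
      · intro i g hg y
        convert κ.range.mul_mem (κ.range.inv_mem (hb i (σ ((b i)⁻¹ * g) y))) (hg y) using 1
        apply Subtype.ext
        simp [mul_assoc]
    rintro ⟨g, hg⟩
    obtain ⟨x, hx⟩ := hall g y₀
    refine ⟨x, hx.trans (Subtype.ext ?_)⟩
    simp [(hF₁ g).1 hg, hτ1]
  have hκθ : κ.comp θ = MonoidHom.id _ := by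
    ext x
    obtain ⟨x, rfl⟩ := hκ x
    have := DFunLike.congr_fun hθκ x
    simp only [MonoidHom.comp_apply, MonoidHom.id_apply] at this ⊢
    rw [this]
  refine ⟨F₁, hNF, E, MonoidHom.toMulEquiv θ κ hκθ hθκ, ?_, hθN⟩
  exact ⟨by rw [Subgroup.index_comap]; exact Subgroup.FiniteIndex.index_ne_zero⟩

/-! ### Finite-index subgroups of free groups -/

theorem Group.FG.finite_monoidHom (G L : Type*) [Group G] [Group L] [Group.FG G] [Finite L] :
    Finite (G →* L) := by
  obtain ⟨S, hS, hfin⟩ := Group.fg_iff.1 (inferInstance : Group.FG G)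
  have : Finite S := hfin
  refine Finite.of_injective (fun (f : G →* L) (s : S) => f s) fun f g h => ?_
  exact MonoidHom.eq_of_eqOn_dense hS fun s hs => congrFun h ⟨s, hs⟩

/-- A finitely generated group has finitely many homomorphisms to `ℤ/2`, and here they correspond to
functions `ι → ℤ/2`. -/
theorem FreeGroupBasis.finite_of_fg {ι F : Type*} [Group F] [Group.FG F]
    (b : FreeGroupBasis ι F) : Finite ι := by
  classical
  have := Group.FG.finite_monoidHom F (Multiplicative (ZMod 2))
  have : Finite (ι → Multiplicative (ZMod 2)) := Finite.of_equiv _ b.lift.symm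
  refine Finite.of_injective
    (fun i : ι => (Pi.mulSingle i (Multiplicative.ofAdd 1) : ι → Multiplicative (ZMod 2)))
    fun i j h => ?_
  by_contra hij
  have := congrFun h i
  simp only [Pi.mulSingle_eq_same, Pi.mulSingle_eq_of_ne hij] at this
  exact absurd this (by decide)

/-- A subgroup of finite index in a free group of finite rank at least two that has the same rank
is the whole group. -/
theorem FreeGroupBasis.eq_top_of_finiteIndex {ι F : Type*} [Group F] [Finite ι]
    (b : FreeGroupBasis ι F) (hι : 2 ≤ Nat.card ι) (M : Subgroup F) [M.FiniteIndex]
    (b' : FreeGroupBasis ι M) : M = ⊤ := by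
  classical
  let L := Multiplicative (ZMod 2)
  have hL : Nat.card L = 2 := by simp [L]
  let Y := F ⧸ M
  let y₀ : Y := ((1 : F) : F ⧸ M)
  let σ : F →* Equiv.Perm Y := MulAction.toPermHom F Y
  have hτ' : ∀ y : Y, ∃ g : F, (g : Y) = y ∧ (y = y₀ → g = 1) := fun y => by
    by_cases hy : y = y₀
    · exact ⟨1, hy.symm, fun _ => rfl⟩
    · obtain ⟨g, hg⟩ := QuotientGroup.mk_surjective y
      exact ⟨g, hg, fun h => absurd h hy⟩
  choose τ hτ hτ1 using hτ'
  have hτ1 : τ y₀ = 1 := hτ1 _ rfl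
  have hσ (g : F) (y : Y) : σ g y = g • y := rfl
  have hστ (y : Y) : σ (τ y) y₀ = y := by
    rw [hσ, MulAction.Quotient.smul_coe, smul_eq_mul, mul_one, hτ]
  have hloop (g : F) (y : Y) : (τ (σ g y))⁻¹ * (g * τ y) ∈ M := by
    rw [← QuotientGroup.eq, hτ, hσ, ← smul_eq_mul, ← MulAction.Quotient.smul_coe, hτ]
  have hM (g : M) : σ g y₀ = y₀ := by
    rw [hσ, MulAction.Quotient.smul_coe, smul_eq_mul, mul_one, QuotientGroup.eq]
    simp
  choose c hc hcl using b.exists_cocycle (L := L) σ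
  let θ (l : ι → Y → L) : M →* L :=
    { toFun := fun g => c l g y₀
      map_one' := cocycle_one (hc l) _
      map_mul' := fun g h => by
        change c l (g * h) y₀ = _
        rw [hc, hM] }
  have hθ (l : ι → Y → L) (i : ι) (y : Y) :
      l i y = c l (τ (σ (b i) y)) y₀ * θ l ⟨_, hloop (b i) y⟩ * (c l (τ y) y₀)⁻¹ := by
    have h1 : c l (b i * τ y) y₀ = l i y * c l (τ y) y₀ := by rw [hc, hστ, hcl]
    have h2 : c l (b i * τ y) y₀ =
        c l (τ (σ (b i) y)) y₀ * θ l ⟨_, hloop (b i) y⟩ := by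
      have := hc l (τ (σ (b i) y)) ((τ (σ (b i) y))⁻¹ * (b i * τ y)) y₀
      rw [mul_inv_cancel_left, hM ⟨_, hloop (b i) y⟩] at this
      exact this
    rw [← h2, h1, mul_inv_cancel_right]
  -- Schreier's index formula by counting: an edge labelling in `ℤ/2` is determined by its holonomy
  -- on `M` and its values along the transversal. With `r` the rank and `m` the index, `r * m ≤ r +
  -- (m - 1)`, so `m = 1` when `r ≥ 2`.
  let Φ : (ι → Y → L) → (M →* L) × ({y : Y // y ≠ y₀} → L) :=
    fun l => (θ l, fun y => c l (τ y) y₀)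
  have hΦ : Function.Injective Φ := by
    intro l l' h
    have h1 : θ l = θ l' := congrArg Prod.fst h
    have h2 (y : Y) : c l (τ y) y₀ = c l' (τ y) y₀ := by
      by_cases hy : y = y₀
      · rw [hy, hτ1, cocycle_one (hc l), cocycle_one (hc l')]
      · exact congrFun (congrArg Prod.snd h) ⟨y, hy⟩
    funext i y
    rw [hθ l, hθ l', h1, h2, h2]
  have : Finite Y := Subgroup.finite_quotient_of_finiteIndex
  have : Finite (M →* L) := Finite.of_equiv _ b'.lift
  have hcard := Nat.card_le_card_of_injective Φ hΦ
  have hpos : 0 < Nat.card Y := Nat.card_pos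
  have hY : Nat.card {y : Y // y ≠ y₀} = Nat.card Y - 1 := by
    have := Fintype.ofFinite Y
    rw [Nat.card_eq_fintype_card, Nat.card_eq_fintype_card, Fintype.card_subtype_compl]
    simp
  rw [Nat.card_prod, Nat.card_fun, Nat.card_fun, Nat.card_fun, hL, hY, Nat.card_congr b'.lift.symm,
    Nat.card_fun, hL, ← pow_mul, ← pow_add, Nat.pow_le_pow_iff_right (by norm_num)] at hcard
  have hone : Nat.card Y = 1 := by
    obtain ⟨k, hk⟩ := Nat.exists_eq_add_of_lt hpos
    obtain ⟨r, hr⟩ := Nat.exists_eq_add_of_le hι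
    rw [hk, hr] at hcard
    have : 0 + k + 1 - 1 = k := by omega
    rw [this] at hcard
    have : k = 0 := by nlinarith
    omega
  exact Subgroup.index_eq_one.1 hone

/-- Every automorphism of a finitely generated group has a positive power preserving a given
subgroup of finite index. -/
theorem MulAut.exists_pow_mem_iff {F : Type*} [Group F] [Group.FG F] (e : MulAut F)
    (F₁ : Subgroup F) [F₁.FiniteIndex] : ∃ K : ℕ, 0 < K ∧ ∀ g, (e ^ K) g ∈ F₁ ↔ g ∈ F₁ := by
  have : Finite (F ⧸ F₁) := Subgroup.finite_quotient_of_finiteIndex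
  have := Group.FG.finite_monoidHom F (Equiv.Perm (F ⧸ F₁))
  let ρ : F →* Equiv.Perm (F ⧸ F₁) := MulAction.toPermHom F (F ⧸ F₁)
  -- Pigeonhole on the finitely many homomorphisms to `Perm (F ⧸ F₁)`; membership in `F₁` can be
  -- read off from `ρ`.
  obtain ⟨i, j, hij, h⟩ := Finite.exists_ne_map_eq_of_infinite
    fun k : ℕ => ρ.comp (e ^ k).toMonoidHom
  wlog hlt : i < j generalizing i j
  · exact this j i hij.symm h.symm (by omega)
  refine ⟨j - i, by omega, fun g => ?_⟩
  have hmem (g : F) : g ∈ F₁ ↔ ρ g ((1 : F) : F ⧸ F₁) = ((1 : F) : F ⧸ F₁) := by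
    change _ ↔ g • ((1 : F) : F ⧸ F₁) = _
    rw [MulAction.Quotient.smul_coe, eq_comm, QuotientGroup.eq]
    simp
  have := DFunLike.congr_fun h ((e ^ i)⁻¹ g)
  simp only [MonoidHom.comp_apply, MulEquiv.toMonoidHom_eq_coe, MonoidHom.coe_coe] at this
  rw [← MulAut.mul_apply, ← MulAut.mul_apply, mul_inv_cancel, MulAut.one_apply,
    ← pow_sub e hlt.le] at this
  rw [hmem, hmem, this]

/-! ### Intersections with the base of an ascending HNN extension -/

namespace AscendingHNNExtension

open HNNExtension

variable {F : Type*} [Group F] {φ : F →* F} {hφ : Function.Injective φ}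

theorem of_injective :
    Function.Injective (of : F →* AscendingHNNExtension φ hφ) := HNNExtension.of_injective _

/-- The homomorphism to `ℤ` killing the base and sending the stable letter to `1`. -/
noncomputable def height (φ : F →* F) (hφ : Function.Injective φ) :
    AscendingHNNExtension φ hφ →* Multiplicative ℤ :=
  lift 1 (Multiplicative.ofAdd 1) (by simp)

theorem height_of (f : F) : height φ hφ (of f) = 1 := by simp [height]

theorem height_t : height φ hφ t = Multiplicative.ofAdd 1 := by simp [height]

theorem t_mul_of (f : F) : (t * of f : AscendingHNNExtension φ hφ) = of (φ f) * t := by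
  rw [← t_mul_of_mul_t_inv φ hφ f, inv_mul_cancel_right]

theorem t_pow_mul_of (k : ℕ) (f : F) :
    (t ^ k * of f : AscendingHNNExtension φ hφ) = of (φ^[k] f) * t ^ k := by
  induction k with
  | zero => simp
  | succ k ih =>
    rw [pow_succ', mul_assoc, ih, ← mul_assoc, t_mul_of, Function.iterate_succ_apply', mul_assoc]

theorem comap_of_fg [Group.FG F] (h : HasFGIP (AscendingHNNExtension φ hφ))
    {H : Subgroup (AscendingHNNExtension φ hφ)} (hH : H.FG) : (H.comap of).FG := by
  have h1 : ((H.comap of).map (of : F →* AscendingHNNExtension φ hφ)).FG := by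
    rw [Subgroup.map_comap_eq]
    exact h _ _ ((Group.fg_iff_subgroup_fg _).1 inferInstance) hH
  rw [← Group.fg_iff_subgroup_fg] at h1 ⊢
  exact Group.fg_of_surjective
    (f := ((H.comap of).equivMapOfInjective _ (of_injective (hφ := hφ))).symm.toMonoidHom)
    (MulEquiv.surjective _)

end AscendingHNNExtension

theorem Subgroup.FG.exists_iSup_le {G : Type*} [Group G] {N : ℕ → Subgroup G} (hN : Monotone N)
    (h : (⨆ k, N k).FG) : ∃ k, ⨆ k, N k ≤ N k := by
  obtain ⟨S, hS⟩ := h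
  have hmem : ∀ x ∈ S, ∃ k, x ∈ N k := fun x hx =>
    (Subgroup.mem_iSup_of_directed hN.directed_le).1 (hS ▸ Subgroup.subset_closure hx)
  choose! k hk using hmem
  refine ⟨S.sup k, ?_⟩
  rw [← hS, Subgroup.closure_le]
  exact fun x hx => hN (Finset.le_sup hx) (hk x hx)

namespace AscendingHNNExtension

open HNNExtension

variable {F : Type*} [Group F] {φ : F →* F}

/-- The retraction kills `b` and fixes `φ(F)`, so it sends `⟨b, φ(N')⟩` into `φ(N')` while fixing `φ
y`; then `φ` is cancelled. Used for the finite stages, to see that the chain grows, and for their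
union, to see that it is closed under `φ`-preimages. -/
theorem mem_of_map_mem_of_retraction (hφ : Function.Injective φ) {F₁ : Subgroup F}
    (hF₁ : ∀ f, φ f ∈ F₁) (r : F₁ →* F) (hr : ∀ f, r ⟨φ f, hF₁ f⟩ = φ f) {b : F} (hb : b ∈ F₁)
    (hrb : r ⟨b, hb⟩ = 1) {N N' : Subgroup F} (hN : N ≤ Subgroup.closure {b} ⊔ N'.map φ) {y : F}
    (hy : φ y ∈ N) : y ∈ N' := by
  have hle : Subgroup.closure {b} ⊔ N'.map φ ≤ ((N'.map φ).comap r).map F₁.subtype := by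
    refine sup_le ?_ ?_
    · rw [Subgroup.closure_le, Set.singleton_subset_iff]
      exact ⟨⟨b, hb⟩, ⟨1, N'.one_mem, by rw [map_one, hrb]⟩, rfl⟩
    · rintro _ ⟨n, hn, rfl⟩
      exact ⟨⟨φ n, hF₁ n⟩, by
        simp only [Subgroup.coe_comap, Set.mem_preimage, hr]
        exact ⟨n, hn, rfl⟩, rfl⟩
  obtain ⟨x, hx, hxy⟩ := hle (hN hy)
  obtain rfl : x = ⟨φ y, hF₁ y⟩ := Subtype.ext hxy
  simp only [Subgroup.coe_comap, Set.mem_preimage, hr] at hx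
  obtain ⟨n, hn, hny⟩ := hx
  exact hφ hny ▸ hn

/-- If `φ(F)` is a retract of a subgroup and the retraction kills some `b ≠ 1`, then `⟨b, t⟩`
meets the base in the infinitely generated subgroup `⟨b, φ b, φ² b, …⟩`. -/
theorem not_hasFGIP_of_retraction [Group.FG F] (hφ : Function.Injective φ) {F₁ : Subgroup F}
    (hF₁ : ∀ f, φ f ∈ F₁) (r : F₁ →* F) (hr : ∀ f, r ⟨φ f, hF₁ f⟩ = φ f) {b : F} (hb : b ∈ F₁)
    (hrb : r ⟨b, hb⟩ = 1) (hb1 : b ≠ 1) : ¬ HasFGIP (AscendingHNNExtension φ hφ) := by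
  intro hG
  let A (k : ℕ) : Subgroup F := Subgroup.closure ((fun i => φ^[i] b) '' Set.Iio k)
  have hA : Monotone A := fun i j hij =>
    Subgroup.closure_mono (Set.image_mono (Set.Iio_subset_Iio hij))
  let N := ⨆ k, A k
  have hbN (i : ℕ) : φ^[i] b ∈ N :=
    Subgroup.mem_iSup_of_mem (i + 1) (Subgroup.subset_closure ⟨i, by simp, rfl⟩)
  have hAφ (k : ℕ) : A (k + 1) ≤ Subgroup.closure {b} ⊔ (A k).map φ := by
    rw [Subgroup.closure_le]
    rintro _ ⟨i, hi, rfl⟩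
    cases i with
    | zero => exact Subgroup.mem_sup_left (Subgroup.subset_closure rfl)
    | succ i =>
      refine Subgroup.mem_sup_right ⟨φ^[i] b, Subgroup.subset_closure ⟨i, ?_, rfl⟩, ?_⟩
      · simpa using hi
      · simp only [Function.iterate_succ_apply']
  have hNφ : N ≤ Subgroup.closure {b} ⊔ N.map φ := iSup_le fun k =>
    ((hA k.le_succ).trans (hAφ k)).trans (sup_le_sup_left (Subgroup.map_mono (le_iSup A k)) _)
  have hφN : ∀ x ∈ N, φ x ∈ N := fun x hx => by
    have : N ≤ N.comap φ := iSup_le fun k => by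
      rw [Subgroup.closure_le]
      rintro _ ⟨i, -, rfl⟩
      have := hbN (i + 1)
      rwa [Function.iterate_succ_apply'] at this
    exact this hx
  have hnot : ∀ k, φ^[k] b ∉ A k := by
    intro k
    induction k with
    | zero => simpa [A] using hb1
    | succ k ih =>
      rw [Function.iterate_succ_apply']
      exact fun h => ih (mem_of_map_mem_of_retraction hφ hF₁ r hr hb hrb (hAφ k) h)
  have hNfg : ¬ N.FG := fun h => by
    obtain ⟨k, hk⟩ := h.exists_iSup_le hA
    exact hnot k (hk (hbN k))
  let H : Subgroup (AscendingHNNExtension φ hφ) := Subgroup.closure {of b, t}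
  have hH : H.FG := (Subgroup.fg_iff _).2 ⟨_, rfl, by simp⟩
  -- As `φ(N) ≤ N`, positive powers of `t` move right past `N`; negative ones are cleared by
  -- multiplying on the left.
  have hform : ∀ x ∈ H, ∃ i j : ℕ, ∃ n ∈ N, t ^ i * x = of n * t ^ j := by
    intro x hx
    have hofb (b' : F) (hb' : ∀ i, φ^[i] b' ∈ N) (x : AscendingHNNExtension φ hφ)
        (hx : ∃ i j : ℕ, ∃ n ∈ N, t ^ i * x = of n * t ^ j) :
        ∃ i j : ℕ, ∃ n ∈ N, t ^ i * (of b' * x) = of n * t ^ j := by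
      obtain ⟨i, j, n, hn, h⟩ := hx
      refine ⟨i, j, φ^[i] b' * n, N.mul_mem (hb' i) hn, ?_⟩
      rw [← mul_assoc, t_pow_mul_of, mul_assoc, h, map_mul, mul_assoc]
    induction hx using Subgroup.closure_induction_left with
    | one => exact ⟨0, 0, 1, N.one_mem, by simp⟩
    | mul_left x hx y _ hy =>
      obtain rfl | rfl := hx
      · exact hofb b hbN y hy
      · obtain ⟨i, j, n, hn, h⟩ := hy
        refine ⟨i, j + 1, φ n, hφN n hn, ?_⟩
        rw [← mul_assoc, ← pow_succ, pow_succ', mul_assoc, h, ← mul_assoc, t_mul_of, mul_assoc,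
          pow_succ']
    | inv_mul_cancel x hx y _ hy =>
      obtain rfl | rfl := hx
      · rw [← map_inv]
        refine hofb b⁻¹ (fun i => ?_) y hy
        rw [iterate_map_inv]
        exact N.inv_mem (hbN i)
      · obtain ⟨i, j, n, hn, h⟩ := hy
        exact ⟨i + 1, j, n, hn, by rw [pow_succ, mul_assoc, mul_inv_cancel_left, h]⟩
  have hiter : ∀ (i : ℕ) (f : F), φ^[i] f ∈ N → f ∈ N := by
    intro i
    induction i with
    | zero => exact fun f h => h
    | succ i ih =>
      intro f h
      rw [Function.iterate_succ_apply'] at h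
      exact ih f (mem_of_map_mem_of_retraction hφ hF₁ r hr hb hrb hNφ h)
  have hHN : H.comap of = N := by
    apply le_antisymm
    · intro f hf
      obtain ⟨i, j, n, hn, h⟩ := hform _ hf
      rw [t_pow_mul_of] at h
      have hij := congrArg (height φ hφ) h
      simp only [map_mul, map_pow, height_of, height_t, one_mul, ← ofAdd_nsmul] at hij
      obtain rfl : i = j := by simpa using hij
      have h1 : φ^[i] f = n := of_injective (mul_right_cancel h)
      exact hiter i f (h1 ▸ hn)
    · refine iSup_le fun k => ?_
      rw [Subgroup.closure_le]
      rintro _ ⟨i, -, rfl⟩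
      change of (φ^[i] b) ∈ H
      have ht : (t : AscendingHNNExtension φ hφ) ∈ H := Subgroup.subset_closure (by simp)
      have hob : (of b : AscendingHNNExtension φ hφ) ∈ H := Subgroup.subset_closure (by simp)
      rw [eq_mul_inv_of_mul_eq (t_pow_mul_of (hφ := hφ) i b).symm]
      exact H.mul_mem (H.mul_mem (H.pow_mem ht i) hob) (H.inv_mem (H.pow_mem ht i))
  exact hNfg (hHN ▸ comap_of_fg hG hH)

open Monoid in
-- Projecting onto the free factor `φ(F)` of `F₁` is the retraction `r`. Infinite index gives `x ∈
-- F₁` outside `φ(F)`, and `x * (r x)⁻¹` is the required element.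
theorem not_hasFGIP_of_not_finiteIndex_range {ι : Type*} [Group.FG F] (b : FreeGroupBasis ι F)
    (hφ : Function.Injective φ) (hind : ¬ φ.range.FiniteIndex) :
    ¬ HasFGIP (AscendingHNNExtension φ hφ) := by
  obtain ⟨F₁, hle, E, Θ, hF₁, hΘ⟩ := b.exists_finiteIndex_mulEquiv_coprod φ.range
    ((Group.fg_iff_subgroup_fg _).1 inferInstance)
  let r : F₁ →* F := (φ.range.subtype.comp (Coprod.fst)).comp Θ.toMonoidHom
  have hφF (f : F) : φ f ∈ F₁ := hle ⟨f, rfl⟩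
  have hr (f : F) : r ⟨φ f, hφF f⟩ = φ f := by
    have : Θ ⟨φ f, hφF f⟩ = Coprod.inl ⟨φ f, f, rfl⟩ := hΘ ⟨φ f, f, rfl⟩
    simp [r, this]
  have hrange (x : F₁) : ∃ f, r x = φ f := by
    obtain ⟨f, hf⟩ := (Coprod.fst (Θ x) : φ.range).2
    exact ⟨f, hf.symm⟩
  obtain ⟨x, hx, hxφ⟩ : ∃ x ∈ F₁, x ∉ φ.range := by
    by_contra! h
    exact hind ((le_antisymm hle h) ▸ hF₁)
  obtain ⟨f, hf⟩ := hrange ⟨x, hx⟩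
  refine not_hasFGIP_of_retraction hφ hφF r hr (b := x * (φ f)⁻¹)
    (F₁.mul_mem hx (F₁.inv_mem (hφF f))) ?_ ?_
  · have : (⟨x * (φ f)⁻¹, F₁.mul_mem hx (F₁.inv_mem (hφF f))⟩ : F₁) =
        ⟨x, hx⟩ * ⟨φ f, hφF f⟩⁻¹ := rfl
    rw [this, map_mul, map_inv, hr, hf, mul_inv_cancel]
  · exact fun h => hxφ ⟨f, (mul_inv_eq_one.1 h).symm⟩

end AscendingHNNExtension

/-! ### Twisted orbits in finitely generated abelian groups -/

/-- If all these orbits were finite, those with `n = 1` would make every `d` periodic under `α`.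
Finite generation then gives `α ^ n = 1` for some `n > 0`, and the orbit for `d₀` consists of the
powers of `d₀`, which are distinct. -/
theorem CommGroup.exists_pow_infinite_twisted_orbit {D : Type*} [CommGroup D] [Group.FG D]
    (α : MulAut D) {d₀ : D} (hd₀ : ∀ n : ℕ, 0 < n → d₀ ^ n ≠ 1) :
    ∃ n : ℕ, 0 < n ∧ ∃ d : D,
      (Set.range fun i : ℕ => (fun x => d * (α ^ n) x)^[i] 1).Infinite := by
  by_contra! hfin
  have hper : ∀ d : D, ∃ k : ℕ, 0 < k ∧ (α ^ k) d = d := by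
    intro d
    let T : D → D := fun x => d * α x
    have hT : Function.Injective T := fun x y h => α.injective (mul_left_cancel h)
    have hfin1 := hfin 1 one_pos d
    rw [pow_one] at hfin1
    have hiter (i : ℕ) (x : D) : T^[i] x = T^[i] 1 * (α ^ i) x := by
      induction i with
      | zero => simp
      | succ i ih =>
        rw [Function.iterate_succ_apply', Function.iterate_succ_apply', ih, pow_succ',
          MulAut.mul_apply]
        simp [T, mul_assoc]
    obtain ⟨i, j, hij, h⟩ : ∃ i j : ℕ, i < j ∧ T^[i] 1 = T^[j] 1 := by
      have : ¬ Function.Injective fun i : ℕ => T^[i] 1 := fun hinj =>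
        Set.infinite_range_of_injective hinj hfin1
      simp only [Function.Injective, not_forall] at this
      obtain ⟨i, j, h, hij⟩ := this
      rcases lt_or_gt_of_ne hij with hlt | hlt
      · exact ⟨i, j, hlt, h⟩
      · exact ⟨j, i, hlt, h.symm⟩
    have h1 : T^[j - i] 1 = 1 := by
      apply hT.iterate i
      rw [← Function.iterate_add_apply, Nat.add_sub_cancel' hij.le, h]
    refine ⟨j - i, by omega, ?_⟩
    have h2 := hiter (j - i) (T 1)
    rw [← Function.iterate_succ_apply, Function.iterate_succ_apply', h1] at h2
    simpa [T] using h2.symm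
  choose k hk hkd using hper
  obtain ⟨S, hS⟩ := Group.fg_def.1 (inferInstance : Group.FG D)
  let n := ∏ s ∈ S, k s
  have hn : 0 < n := Finset.prod_pos fun s _ => hk s
  have hαn : ∀ x, (α ^ n) x = x := by
    have : (α ^ n).toMonoidHom = MonoidHom.id D := MonoidHom.eq_of_eqOn_dense hS fun s hs => by
      obtain ⟨m, hm⟩ := Finset.dvd_prod_of_mem k hs
      change (α ^ n) s = s
      rw [show n = k s * m from hm, pow_mul]
      clear hm
      induction m with
      | zero => simp
      | succ m ih => rw [pow_succ, MulAut.mul_apply, hkd, ih]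
    exact fun x => DFunLike.congr_fun this x
  have hpow (i : ℕ) : (fun x => d₀ * (α ^ n) x)^[i] 1 = d₀ ^ i := by
    induction i with
    | zero => simp
    | succ i ih => rw [Function.iterate_succ_apply', ih, hαn, pow_succ']
  have hfin2 := hfin n hn d₀
  simp only [hpow] at hfin2
  refine Set.infinite_range_of_injective (fun i j h => ?_) hfin2
  rcases lt_trichotomy i j with hlt | rfl | hlt
  · refine absurd ?_ (hd₀ (j - i) (by omega))
    rw [pow_sub _ hlt.le, show d₀ ^ i = d₀ ^ j from h, mul_inv_cancel]
  · rfl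
  · refine absurd ?_ (hd₀ (i - j) (by omega))
    rw [pow_sub _ hlt.le, show d₀ ^ i = d₀ ^ j from h, mul_inv_cancel]

/-! ### The base of a regular wreath product -/

namespace RegularWreathProduct

variable {A D : Type*} [Group A] [Group D]

/-- The elements of the base group supported in `W`. -/
def baseSupportedIn (A : Type*) {D : Type*} [Group A] [Group D] (W : Set D) :
    Subgroup (A ≀ᵣ D) where
  carrier := {w | w.right = 1 ∧ ∀ x ∉ W, w.left x = 1}
  one_mem' := ⟨rfl, fun _ _ => rfl⟩
  mul_mem' := fun {v w} hv hw =>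
    ⟨by simp [hv.1, hw.1], fun x hx => by simp [hv.1, hv.2 x hx, hw.2 x hx]⟩
  inv_mem' := fun {w} hw => ⟨by simp [hw.1], fun x hx => by simp [hw.1, hw.2 x hx]⟩

theorem baseSupportedIn_mono {V W : Set D} (h : V ⊆ W) :
    baseSupportedIn A V ≤ baseSupportedIn A W :=
  fun _ hw => ⟨hw.1, fun x hx => hw.2 x fun hV => hx (h hV)⟩

theorem conj_left {w : A ≀ᵣ D} (hw : w.right = 1) (g : A ≀ᵣ D) (x : D) :
    (g * w * g⁻¹).left x = g.left x * w.left (g.right⁻¹ * x) * (g.left x)⁻¹ := by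
  simp [hw]

/-- The finitely supported elements of the base group. -/
def finiteBase (A D : Type*) [Group A] [Group D] : Subgroup (A ≀ᵣ D) where
  carrier := {w | ∃ W : Set D, W.Finite ∧ w ∈ baseSupportedIn A W}
  one_mem' := ⟨∅, Set.finite_empty, one_mem _⟩
  mul_mem' := fun ⟨V, hV, hv⟩ ⟨W, hW, hw⟩ => ⟨V ∪ W, hV.union hW,
    mul_mem (baseSupportedIn_mono Set.subset_union_left hv)
      (baseSupportedIn_mono Set.subset_union_right hw)⟩
  inv_mem' := fun ⟨W, hW, hw⟩ => ⟨W, hW, inv_mem hw⟩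

/-- Conjugation by `g` translates supports by `g.right`. Normality lets a whole normal closure be
placed in the finitely supported part. -/
instance finiteBase_normal : (finiteBase A D).Normal where
  conj_mem := fun w ⟨W, hW, hw⟩ g => by
    refine ⟨(fun x => g.right * x) '' W, hW.image _, by simp [hw.1], fun x hx => ?_⟩
    rw [conj_left hw.1, hw.2, mul_one, mul_inv_cancel]
    exact fun h => hx ⟨_, h, by simp⟩

open Classical in
/-- The copy of `A` at the coordinate `1` of the base group. -/
noncomputable def single (A D : Type*) [Group A] [Group D] : A →* A ≀ᵣ D where
  toFun a := ⟨Pi.mulSingle 1 a, 1⟩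
  map_one' := by ext <;> simp
  map_mul' a b := by
    ext x
    · simp [Pi.mulSingle_mul]
    · simp

theorem single_mem (a : A) : single A D a ∈ baseSupportedIn A {(1 : D)} :=
  ⟨rfl, fun x hx => by
    classical
    have hx : x ≠ 1 := hx
    simp [single, hx]⟩

theorem single_left_one (a : A) : (single A D a).left 1 = a := by
  simp [single]

end RegularWreathProduct

/-! ### The case of an automorphism -/

namespace AscendingHNNExtension

open HNNExtension

variable {F : Type*} [Group F] {φ : F →* F} {hφ : Function.Injective φ}

theorem of_pow_apply {e : MulAut F} (he : ∀ f, e f = φ f) (k : ℕ) (f : F) :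
    (of ((e ^ k) f) : AscendingHNNExtension φ hφ) = t ^ k * of f * (t ^ k)⁻¹ := by
  have : (e ^ k) f = φ^[k] f := by
    induction k with
    | zero => simp
    | succ k ih => rw [pow_succ', MulAut.mul_apply, ih, he, Function.iterate_succ_apply']
  rw [this, t_pow_mul_of, mul_inv_cancel_right]

/-- Adjoining an element `of c * t ^ k` that normalizes a subgroup `R` of the base does not enlarge
the intersection with the base. -/
theorem comap_of_closure_le {e : MulAut F} (he : ∀ f, e f = φ f) {k : ℕ} (hk : 0 < k) {c : F}
    {R : Subgroup F} (hR : ∀ f, c * (e ^ k) f * c⁻¹ ∈ R ↔ f ∈ R) :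
    (Subgroup.closure (insert (of c * t ^ k) (of '' R)) :
      Subgroup (AscendingHNNExtension φ hφ)).comap of ≤ R := by
  set s : AscendingHNNExtension φ hφ := of c * t ^ k with hs
  have hconj (f : F) : s * of f = of (c * (e ^ k) f * c⁻¹) * s := by
    rw [map_mul, map_mul, of_pow_apply he, hs, map_inv]
    group
  -- `s` normalizes `R`, so its powers collect on the right; since `s` has height `k > 0`, an
  -- element of the base has `m = 0`.
  have hform : ∀ x ∈ Subgroup.closure (insert s (of '' (R : Set F))),
      ∃ r ∈ R, ∃ m : ℤ, x = of r * s ^ m := by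
    intro x hx
    induction hx using Subgroup.closure_induction_left with
    | one => exact ⟨1, R.one_mem, 0, by simp⟩
    | mul_left x hx y _ hy =>
      obtain ⟨r, hr, m, rfl⟩ := hy
      obtain rfl | ⟨f, hf, rfl⟩ := hx
      · exact ⟨_, (hR r).2 hr, 1 + m, by rw [← mul_assoc, hconj, mul_assoc, zpow_one_add]⟩
      · exact ⟨f * r, R.mul_mem hf hr, m, by rw [map_mul, mul_assoc]⟩
    | inv_mul_cancel x hx y _ hy =>
      obtain ⟨r, hr, m, rfl⟩ := hy
      obtain rfl | ⟨f, hf, rfl⟩ := hx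
      · have h1 : c * (e ^ k) ((e ^ k).symm (c⁻¹ * r * c)) * c⁻¹ = r := by
          rw [MulEquiv.apply_symm_apply]; group
        refine ⟨(e ^ k).symm (c⁻¹ * r * c), (hR _).1 (h1.symm ▸ hr), -1 + m, ?_⟩
        have h2 := hconj ((e ^ k).symm (c⁻¹ * r * c))
        rw [h1] at h2
        rw [inv_mul_eq_iff_eq_mul, ← mul_assoc, h2, zpow_add, zpow_neg_one]
        group
      · exact ⟨f⁻¹ * r, R.mul_mem (R.inv_mem hf) hr, m, by rw [map_mul, map_inv, mul_assoc]⟩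
  intro f hf
  obtain ⟨r, hr, m, h⟩ := hform _ hf
  have hm := congrArg (height φ hφ) h
  rw [map_mul, map_zpow, height_of, height_of, one_mul, hs, map_mul, map_pow, height_of, height_t,
    one_mul, ← ofAdd_nsmul, ← ofAdd_zsmul] at hm
  have hm : m = 0 := by
    have := Multiplicative.ofAdd.injective (hm.symm.trans ofAdd_zero.symm)
    simpa [hk.ne'] using this
  rw [hm, zpow_zero, mul_one] at h
  exact of_injective h ▸ hr

end AscendingHNNExtension

open Monoid in
-- The free product allows `N` to be sent to the coordinate `1` and the free factor to `D` through
-- `q`. A conjugate `g * n * g⁻¹` is then supported at `q g`, which tells conjugates of `N` apart.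
theorem exists_monoidHom_regularWreathProduct {F D E : Type*} [Group F] [Group D]
    {F₁ N : Subgroup F} (hle : N ≤ F₁) (Θ : F₁ ≃* Coprod N (FreeGroup E))
    (hΘ : ∀ n : N, Θ (Subgroup.inclusion hle n) = Coprod.inl n) (q : F₁ →* D)
    (hq : ∀ n : N, q (Subgroup.inclusion hle n) = 1) :
    ∃ θ : F₁ →* N ≀ᵣ D, (∀ x, (θ x).right = q x) ∧
      ∀ n : N, θ (Subgroup.inclusion hle n) = RegularWreathProduct.single N D n := by
  let η : Coprod N (FreeGroup E) →* N ≀ᵣ D := Coprod.lift (RegularWreathProduct.single N D)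
    (RegularWreathProduct.inl.comp ((q.comp Θ.symm.toMonoidHom).comp Coprod.inr))
  have hη : RegularWreathProduct.rightHom.comp η = q.comp Θ.symm.toMonoidHom := by
    refine Coprod.hom_ext ?_ ?_
    · ext n
      have h1 : Θ.symm (Coprod.inl n) = Subgroup.inclusion hle n := by
        rw [← hΘ, MulEquiv.symm_apply_apply]
      have h2 : η (Coprod.inl n) = RegularWreathProduct.single N D n := by simp [η]
      simp only [MonoidHom.comp_apply, MulEquiv.toMonoidHom_eq_coe, MonoidHom.coe_coe, h1, h2, hq]
      rfl
    · ext x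
      simp [η]
  refine ⟨η.comp Θ.toMonoidHom, fun x => ?_, fun n => ?_⟩
  · have := DFunLike.congr_fun hη (Θ x)
    simpa using this
  · simp [hΘ, η]

theorem MulAut.pow_mem_iff_of_mem_iff {F : Type*} [Group F] {e : MulAut F} {N : Subgroup F}
    (he : ∀ f, e f ∈ N ↔ f ∈ N) (k : ℕ) (f : F) : (e ^ k) f ∈ N ↔ f ∈ N := by
  induction k with
  | zero => simp
  | succ k ih => rw [pow_succ', MulAut.mul_apply, he, ih]

open Monoid in
/-- Let `N` be a nontrivial finitely generated subgroup of infinite index in a finitely generated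
free group, invariant under an automorphism `e`. Then some `ψ = c * e ^ k(·) * c⁻¹` normalizes a
subgroup `R ≥ N` in which no `ψ`-stable subgroup containing `N` is finitely generated. -/
theorem FreeGroupBasis.exists_twisted_conj_not_fg {ι F : Type*} [Group F] [Group.FG F]
    (b : FreeGroupBasis ι F) (e : MulAut F) (N : Subgroup F) (hN : N.FG) (hN1 : N ≠ ⊥)
    (hind : ¬ N.FiniteIndex) (he : ∀ f, e f ∈ N ↔ f ∈ N) :
    ∃ k : ℕ, 0 < k ∧ ∃ (c : F) (R : Subgroup F), N ≤ R ∧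
      (∀ f, c * (e ^ k) f * c⁻¹ ∈ R ↔ f ∈ R) ∧
      ∀ P ≤ R, N ≤ P → (∀ x ∈ P, c * (e ^ k) x * c⁻¹ ∈ P) → ¬ P.FG := by
  obtain ⟨F₁, hle, E, Θ, hF₁, hΘ⟩ := b.exists_finiteIndex_mulEquiv_coprod N hN
  obtain ⟨K, hK, heF₁⟩ := e.exists_pow_mem_iff F₁
  let ψ : MulAut F₁ :=
    ((e ^ K).subgroupMap F₁).trans (MulEquiv.subgroupCongr (by
      ext x
      constructor
      · rintro ⟨y, hy, rfl⟩
        exact (heF₁ y).2 hy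
      · intro hx
        refine ⟨(e ^ K).symm x, (heF₁ _).1 ?_, ?_⟩ <;> simp [hx]))
  have hψ (x : F₁) : (ψ x : F) = (e ^ K) x := rfl
  have hψpow (n : ℕ) (x : F₁) : ((ψ ^ n) x : F) = (e ^ (K * n)) x := by
    induction n with
    | zero => simp
    | succ n ih =>
      rw [pow_succ', MulAut.mul_apply, hψ, ih, ← MulAut.mul_apply, ← pow_add, mul_add_one,
        add_comm]
  let N₁ : Subgroup F₁ := N.subgroupOf F₁
  let R₁ : Subgroup F₁ := Subgroup.normalClosure (N₁ : Set F₁)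
  have hNR₁ (n : N) : Subgroup.inclusion hle n ∈ R₁ :=
    Subgroup.subset_normalClosure (by simp [N₁, Subgroup.mem_subgroupOf])
  have hψN₁ : N₁.map ψ.toMonoidHom = N₁ := by
    ext x
    constructor
    · rintro ⟨y, hy, rfl⟩
      exact (MulAut.pow_mem_iff_of_mem_iff he K y).2 hy
    · intro hx
      refine ⟨ψ.symm x, ?_, by simp⟩
      refine (MulAut.pow_mem_iff_of_mem_iff he K (ψ.symm x : F)).1 ?_
      rw [← hψ, MulEquiv.apply_symm_apply]
      exact hx
  have hψR₁ : R₁.map ψ.toMonoidHom = R₁ := by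
    have := Subgroup.map_normalClosure (N₁ : Set F₁) ψ.toMonoidHom ψ.surjective
    rw [this]
    have h2 : ψ.toMonoidHom '' (N₁ : Set F₁) = (N₁ : Set F₁) := by
      rw [← Subgroup.coe_map, hψN₁]
    rw [h2]
  have hψR₁' (n : ℕ) (x : F₁) : (ψ ^ n) x ∈ R₁ ↔ x ∈ R₁ := by
    refine MulAut.pow_mem_iff_of_mem_iff (fun x => ?_) n x
    conv_lhs => rw [← hψR₁]
    constructor
    · rintro ⟨y, hy, h⟩
      exact ψ.injective h ▸ hy
    · exact fun hx => ⟨x, hx, rfl⟩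
  -- Abelianizing keeps the free letters of infinite order and makes the twisted orbit lemma
  -- applicable.
  let D := Abelianization (F₁ ⧸ R₁)
  let q : F₁ →* D := Abelianization.of.comp (QuotientGroup.mk' R₁)
  have hq : Function.Surjective q :=
    (QuotientGroup.mk'_surjective (commutator (F₁ ⧸ R₁))).comp (QuotientGroup.mk'_surjective R₁)
  have hqN (n : N) : q (Subgroup.inclusion hle n) = 1 := by
    have : QuotientGroup.mk' R₁ (Subgroup.inclusion hle n) = 1 :=
      (QuotientGroup.eq_one_iff _).2 (hNR₁ n)
    rw [MonoidHom.comp_apply, this, map_one]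
  let α : MulAut D := (QuotientGroup.congr R₁ R₁ ψ hψR₁).abelianizationCongr
  have hα (x : F₁) : α (q x) = q (ψ x) := rfl
  have hαpow (n : ℕ) (x : F₁) : (α ^ n) (q x) = q ((ψ ^ n) x) := by
    induction n with
    | zero => rfl
    | succ n ih => rw [pow_succ', pow_succ', MulAut.mul_apply, MulAut.mul_apply, ih, hα]
  have : Group.FG F₁ := inferInstance
  have : Group.FG D := Group.fg_of_surjective hq
  obtain ⟨ε⟩ : Nonempty E := by
    by_contra hE
    rw [not_nonempty_iff] at hE
    refine hind ?_
    have : F₁ ≤ N := fun x hx => by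
      have h1 : ∀ w : Coprod N (FreeGroup E), ∃ n : N, w = Coprod.inl n := by
        intro w
        induction w using Coprod.induction_on with
        | inl n => exact ⟨n, rfl⟩
        | inr x => exact ⟨1, by rw [Subsingleton.elim x 1, map_one, map_one]⟩
        | mul x y hx hy =>
          obtain ⟨m, rfl⟩ := hx
          obtain ⟨n, rfl⟩ := hy
          exact ⟨m * n, (map_mul _ _ _).symm⟩
      obtain ⟨n, hn⟩ := h1 (Θ ⟨x, hx⟩)
      rw [← hΘ] at hn
      have h2 : x = n := congrArg Subtype.val (Θ.injective hn)
      exact h2 ▸ n.2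
    exact le_antisymm hle this ▸ hF₁
  obtain ⟨d₀, hd₀⟩ : ∃ d₀ : D, ∀ n : ℕ, 0 < n → d₀ ^ n ≠ 1 := by
    -- Exponent sum in the free letters kills `N`, hence descends to `D` and detects the letter `ε`.
    let χ : F₁ →* Multiplicative ℤ := (Coprod.lift (1 : N →* Multiplicative ℤ)
      (FreeGroup.lift fun _ : E => Multiplicative.ofAdd (1 : ℤ))).comp Θ.toMonoidHom
    have hχR : R₁ ≤ χ.ker := by
      refine Subgroup.normalClosure_le_normal ?_
      intro x hx
      have : Θ x = Coprod.inl ⟨x, hx⟩ := hΘ ⟨x, hx⟩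
      change Coprod.lift _ _ (Θ x) = 1
      rw [this, Coprod.lift_apply_inl, MonoidHom.one_apply]
    let χ' : D →* Multiplicative ℤ := Abelianization.lift (QuotientGroup.lift R₁ χ hχR)
    have hχ' (x : F₁) : χ' (q x) = χ x := rfl
    refine ⟨q (Θ.symm (Coprod.inr (FreeGroup.of ε))), fun n hn h => ?_⟩
    have h1 := congrArg χ' h
    rw [map_pow, hχ', map_one] at h1
    simp only [χ, MonoidHom.comp_apply, MulEquiv.toMonoidHom_eq_coe, MonoidHom.coe_coe,
      MulEquiv.apply_symm_apply, Coprod.lift_apply_inr, FreeGroup.lift_apply_of] at h1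
    rw [← ofAdd_nsmul, ofAdd_eq_one] at h1
    simp at h1
    omega
  obtain ⟨n, hn, d, hd⟩ := CommGroup.exists_pow_infinite_twisted_orbit α hd₀
  obtain ⟨c, rfl⟩ := hq d
  obtain ⟨θ, hθq, hθN⟩ := exists_monoidHom_regularWreathProduct hle Θ hΘ q hqN
  have hconj (x : F₁) : ((c * (ψ ^ n) x * c⁻¹ : F₁) : F) = c * (e ^ (K * n)) x * (c : F)⁻¹ := by
    simp [hψpow]
  refine ⟨K * n, Nat.mul_pos hK hn, c, R₁.map F₁.subtype, ?_, ?_, ?_⟩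
  · exact fun x hx => ⟨_, hNR₁ ⟨x, hx⟩, rfl⟩
  · intro f
    constructor
    · rintro ⟨y, hy, hyf⟩
      have hf : f ∈ F₁ := by
        have h1 : (c : F) * (e ^ (K * n)) f * (c : F)⁻¹ ∈ F₁ := hyf ▸ y.2
        have h2 : (e ^ (K * n)) f ∈ F₁ := by
          have := F₁.mul_mem (F₁.mul_mem (F₁.inv_mem c.2) h1) c.2
          simpa [mul_assoc] using this
        rw [pow_mul] at h2
        exact (MulAut.pow_mem_iff_of_mem_iff heF₁ n f).1 h2
      have h3 : y = c * (ψ ^ n) ⟨f, hf⟩ * c⁻¹ := Subtype.ext (by rw [hconj]; exact hyf)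
      refine ⟨⟨f, hf⟩, (hψR₁' n _).1 ?_, rfl⟩
      have hR₁ : R₁.Normal := Subgroup.normalClosure_normal
      have := hR₁.conj_mem y hy c⁻¹
      rw [h3] at this
      simpa [mul_assoc] using this
    · rintro ⟨x, hx, rfl⟩
      have hR₁ : R₁.Normal := Subgroup.normalClosure_normal
      exact ⟨_, hR₁.conj_mem _ ((hψR₁' n x).2 hx) c, hconj x⟩
  · intro P hPR hNP hP hfg
    have hbase : R₁ ≤ (RegularWreathProduct.finiteBase N D).comap θ := by
      refine Subgroup.normalClosure_le_normal ?_
      intro x hx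
      have : θ x = _ := hθN ⟨x, hx⟩
      rw [SetLike.mem_coe, Subgroup.mem_comap, this]
      exact ⟨{1}, Set.finite_singleton _, RegularWreathProduct.single_mem _⟩
    -- Finitely many generators of `P` have a common finite support `W`.
    obtain ⟨W, hW, hPW⟩ : ∃ W : Set D, W.Finite ∧
        P ≤ ((RegularWreathProduct.baseSupportedIn N W).comap θ).map F₁.subtype := by
      obtain ⟨S, hS⟩ := hfg
      have h1 : ∀ s ∈ S, ∃ W : Set D, W.Finite ∧
          s ∈ ((RegularWreathProduct.baseSupportedIn N W).comap θ).map F₁.subtype := by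
        intro s hs
        obtain ⟨x, hx, rfl⟩ := hPR (hS ▸ Subgroup.subset_closure hs)
        obtain ⟨W, hW, hxW⟩ := hbase hx
        exact ⟨W, hW, x, hxW, rfl⟩
      choose! W hW hsW using h1
      refine ⟨⋃ s ∈ S, W s, S.finite_toSet.biUnion hW, ?_⟩
      rw [← hS, Subgroup.closure_le]
      intro s hs
      exact Subgroup.map_mono (Subgroup.comap_mono (RegularWreathProduct.baseSupportedIn_mono
        (Set.subset_biUnion_of_mem (u := W) hs))) (hsW s hs)
    let C (i : ℕ) : F₁ := (fun x => c * (ψ ^ n) x)^[i] 1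
    have hC (i : ℕ) : C (i + 1) = c * (ψ ^ n) (C i) := Function.iterate_succ_apply' _ _ _
    have hqC (i : ℕ) : q (C i) = (fun x => q c * (α ^ n) x)^[i] 1 := by
      induction i with
      | zero => simp [C]
      | succ i ih => rw [hC, Function.iterate_succ_apply', ← ih, map_mul, hαpow]
    -- Each twisted conjugation carries the `C i`-conjugate of `N` onto the `C (i + 1)`-conjugate.
    -- These have supports `q (C i)`, an infinite set, which contradicts the finiteness of `W`.
    have hCP : ∀ (i : ℕ) (m : N), ((C i * Subgroup.inclusion hle m * (C i)⁻¹ : F₁) : F) ∈ P := by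
      intro i
      induction i with
      | zero => intro m; simpa [C] using hNP m.2
      | succ i ih =>
        intro m
        have hm : (e ^ (K * n)).symm m ∈ N := by
          refine (MulAut.pow_mem_iff_of_mem_iff he (K * n) _).1 ?_
          simp
        have h1 := hP _ (ih ⟨_, hm⟩)
        rw [← hconj, map_mul, map_mul, map_inv] at h1
        have h2 : (ψ ^ n) (Subgroup.inclusion hle ⟨_, hm⟩) = Subgroup.inclusion hle m :=
          Subtype.ext (by rw [hψpow]; simp)
        rw [h2] at h1
        rw [hC]
        simpa [mul_assoc] using h1
    obtain ⟨m, hm1⟩ := Subgroup.ne_bot_iff_exists_ne_one.1 hN1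
    refine hd (hW.subset ?_)
    rintro _ ⟨i, rfl⟩
    change (fun x => q c * (α ^ n) x)^[i] 1 ∈ W
    rw [← hqC]
    by_contra hnot
    obtain ⟨x, hx, hxC⟩ := hPW (hCP i m)
    obtain rfl := Subtype.ext hxC
    have h1 := hx.2 _ hnot
    rw [map_mul, map_mul, map_inv, hθN, RegularWreathProduct.conj_left rfl, hθq, inv_mul_cancel,
      RegularWreathProduct.single_left_one, mul_inv_eq_one, mul_eq_left] at h1
    exact hm1 h1

namespace AscendingHNNExtension

open HNNExtension

theorem not_hasFGIP_of_surjective {F ι : Type*} [Group F] [Group.FG F] (b : FreeGroupBasis ι F)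
    [Nontrivial ι] {φ : F →* F} (hφ : Function.Injective φ) (hsurj : Function.Surjective φ) :
    ¬ HasFGIP (AscendingHNNExtension φ hφ) := by
  classical
  intro hG
  let e : MulAut F := MulEquiv.ofBijective φ ⟨hφ, hsurj⟩
  have he (f : F) : e f = φ f := rfl
  obtain ⟨i, j, hij⟩ := exists_pair_ne ι
  let x : F := b i * b j * (b i)⁻¹ * (b j)⁻¹
  have hx1 : x ≠ 1 := fun h => by
    -- Two non-commuting transpositions witness that the commutator is nontrivial.
    let f : F →* Equiv.Perm (Fin 3) :=
      b.lift (Function.update (fun _ => Equiv.swap 1 2) i (Equiv.swap 0 1))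
    have h1 : f (b i) = Equiv.swap 0 1 := by simp [f, b.lift_apply_basis]
    have h2 : f (b j) = Equiv.swap 1 2 := by
      simp [f, b.lift_apply_basis, Function.update_of_ne hij.symm]
    have h3 := congrArg f h
    simp only [x, map_mul, map_inv, h1, h2, map_one] at h3
    exact absurd h3 (by decide)
  have hxc : x ∈ commutator F :=
    Subgroup.commutator_mem_commutator (Subgroup.mem_top _) (Subgroup.mem_top _)
  let H : Subgroup (AscendingHNNExtension φ hφ) := Subgroup.closure {t, of x}
  have hH : H.FG := (Subgroup.fg_iff _).2 ⟨_, rfl, by simp⟩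
  have ht : t ∈ H := Subgroup.subset_closure (by simp)
  let N : Subgroup F := H.comap of
  have hxN : x ∈ N := Subgroup.subset_closure (by simp)
  have hNc : N ≤ commutator F := by
    refine le_trans (Subgroup.comap_mono ?_)
      (comap_of_closure_le (hφ := hφ) he one_pos (c := 1) (R := commutator F) fun f => ?_)
    · refine Subgroup.closure_mono ?_
      rintro _ (rfl | rfl)
      · simp
      · exact Set.mem_insert_of_mem _ ⟨x, hxc, rfl⟩
    · rw [pow_one, one_mul, inv_one, mul_one]
      have h1 (e : MulAut F) (f : F) (hf : f ∈ commutator F) : e f ∈ commutator F :=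
        (Subgroup.characteristic_iff_map_le.1 inferInstance e) ⟨f, hf, rfl⟩
      refine ⟨fun h => ?_, h1 e f⟩
      simpa using h1 e⁻¹ _ h
  -- A basis element has infinite order modulo `[F, F]`, which contains `N`.
  have hind : ¬ N.FiniteIndex := fun h => by
    obtain ⟨m, hm, -, hmN⟩ := Subgroup.exists_pow_mem_of_index_ne_zero h.index_ne_zero (b i)
    let χ : F →* Multiplicative ℤ := b.lift fun _ => Multiplicative.ofAdd 1
    have h1 : χ (b i ^ m) = 1 := Abelianization.commutator_subset_ker χ (hNc hmN)
    rw [map_pow, b.lift_apply_basis, ← ofAdd_nsmul, ofAdd_eq_one] at h1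
    simp at h1
    omega
  have heN (f : F) : e f ∈ N ↔ f ∈ N := by
    have h1 : (of (e f) : AscendingHNNExtension φ hφ) = t * of f * t⁻¹ :=
      (t_mul_of_mul_t_inv φ hφ f).symm
    change of (e f) ∈ H ↔ of f ∈ H
    rw [h1, H.mul_mem_cancel_right (H.inv_mem ht), H.mul_mem_cancel_left ht]
  have hNfg : N.FG := comap_of_fg hG hH
  obtain ⟨k, hk, c, R, hNR, hR, hP⟩ := b.exists_twisted_conj_not_fg e N hNfg
    (fun h => hx1 ((Subgroup.mem_bot).1 (h ▸ hxN))) hind heN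
  let s : AscendingHNNExtension φ hφ := of c * t ^ k
  let H' : Subgroup (AscendingHNNExtension φ hφ) := Subgroup.closure {s} ⊔ N.map of
  have hs : s ∈ H' := Subgroup.mem_sup_left (Subgroup.subset_closure rfl)
  have hH' : H'.FG := by
    refine Subgroup.FG.sup ((Subgroup.fg_iff _).2 ⟨_, rfl, by simp⟩) ?_
    rw [← Group.fg_iff_subgroup_fg] at hNfg ⊢
    exact Group.fg_of_surjective (MonoidHom.subgroupMap_surjective of N)
  refine hP (H'.comap of) (le_trans (Subgroup.comap_mono ?_) (comap_of_closure_le he hk hR))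
    (fun x hx => Subgroup.mem_sup_right ⟨x, hx, rfl⟩) (fun x hx => ?_) (comap_of_fg hG hH')
  · refine sup_le (Subgroup.closure_mono (by simp [s])) ?_
    rintro _ ⟨x, hx, rfl⟩
    exact Subgroup.subset_closure (Set.mem_insert_of_mem _ ⟨x, hNR hx, rfl⟩)
  · have h1 : (of (c * (e ^ k) x * c⁻¹) : AscendingHNNExtension φ hφ) = s * of x * s⁻¹ := by
      rw [map_mul, map_mul, of_pow_apply he, map_inv]
      simp only [s]
      group
    rw [Subgroup.mem_comap, h1]
    exact H'.mul_mem (H'.mul_mem hs hx) (H'.inv_mem hs)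

end AscendingHNNExtension

theorem theorem1 {F ι : Type*} [Group F] [Group.FG F] (b : FreeGroupBasis ι F)
    (hrank : 2 ≤ Cardinal.mk ι) (φ : F →* F) (hφ : Function.Injective φ) :
    ¬ HasFGIP (AscendingHNNExtension φ hφ) := by
  have : Finite ι := b.finite_of_fg
  have hcard : 2 ≤ Nat.card ι := by
    rw [← Nat.cast_card] at hrank
    exact_mod_cast hrank
  by_cases hind : φ.range.FiniteIndex
  · have : Nontrivial ι := Finite.one_lt_card_iff_nontrivial.1 hcard
    -- By injectivity `φ(F)` has a basis indexed by `ι`, so finite index and equal rank give `φ(F) =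
    -- F`.
    exact AscendingHNNExtension.not_hasFGIP_of_surjective b hφ (MonoidHom.range_eq_top.1
      (b.eq_top_of_finiteIndex hcard φ.range (b.map (MonoidHom.ofInjective hφ))))
  · exact AscendingHNNExtension.not_hasFGIP_of_not_finiteIndex_range b hφ hind
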